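/- **Setting (non-preemptive machine replenishment).** There are finitely many independent machines. Machine $i$ has a finite set $\mathcal S_i$ of active states with transition probabilities $p_{uv}$, rewards $r_u\ge 0$, repair costs $c_u\ge 0$, an initial active state $\rho_i$, and a repair success probability $s_i\in(0,1]$. At the beginning of each time slot a scheduling policy (which may be randomized and may depend on the whole history) may move any active machine $i$, in state $u$, to the repair queue at cost $c_u$, and may start the repair of machines in the queue (including those just moved), as long as at most $M$ machines are then under repair. A repair that has been started cannot be interrupted; in each slot in which machine $i$ is under repair, the repair completes at the end of the slot with probability $s_i$, independently of everything else, and then the machine begins the next slot in state $\rho_i$. A machine that is active in state $u$ during a slot earns $r_u$ and begins the next slot in state $v$ with probability $p_{uv}$; a machine in the repair queue earns nothing. All machines start in their initial active states, and the value of a policy is its expected long-run time-average reward minus cost. The optimal value is the supremum of the values of all policies (with $\limsup$ averages). The *Whittle index* of a state $u\in\mathcal S_i$ is the largest penalty $\lambda\in\mathbb R$ per step of maintenance for which an average-optimal policy for machine $i$ alone (reward minus cost, minus $\lambda$ for each slot under repair, where a machine sent to the queue is worked on at once and until its repair completes) still sends the machine to repair in state $u$. The *Whittle index policy* gives, at the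 beginning of every slot, the free repair capacity (after machines already waiting in the queue, if any) to the active machines of highest index among those of non-negative index, ties being broken arbitrarily. **Theorem.** For $n\ge 2$ consider the instance with $M=1$ and two machines $i\in\{1,2\}$, where $\mathcal S_i=\{\rho_i,b_i\}$, $r_{\rho_i}=1$, $r_{b_i}=0$, all costs are $0$, machine $i$ in state $\rho_i$ moves to $b_i$ with probability $p_i$ per slot, $b_i$ is left only through repair, and $$p_1=\frac1n,\qquad s_1=\frac1{n^4},\qquad p_2=s_2=1 .$$ There is a constant $C>0$ such that for every $n\ge 2$: 1. the optimal value is $\tfrac12$, and some policy has time-average reward (as a limit) equal to $\tfrac12$; 2. Whittle index policies exist, and each of them has a time-average reward $w$ (as a limit) with $0<w\le C/n^3$. Consequently the Whittle index policy is an arbitrarily poor approximation for non-preemptive machine replenishment even with two machines and $M=1$: for every $\alpha\in\mathbb R$ there is $n\ge 2$ such that, on this instance, $\alpha$ times the value of any Whittle index policy is less than the optimal value. -/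

import Mathlib

open Filter Topology

/-! ### Finite Markov decision processes and the long-run average reward -/

/-- A Markov decision process with finitely many states and actions: `allowed x a` says that the
action `a` may be taken in state `x`, `trans x a y` is the probability of moving to `y`. -/
structure MDP (X A : Type) [Fintype X] [Fintype A] where
  allowed : X → A → Prop
  exists_allowed : ∀ x, ∃ a, allowed x a
  reward : X → A → ℝ
  trans : X → A → X → ℝ
  trans_nonneg : ∀ x a y, 0 ≤ trans x a y
  trans_sum : ∀ x a, ∑ y, trans x a y = 1

namespace MDP

variable {X A : Type} [Fintype X] [Fintype A]

/-- A policy may be randomized and may depend on the whole history (the list of past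
state-action pairs, the most recent one first) and on the current state.  `prob h x a` is the
probability of choosing the action `a`. -/
structure Policy (D : MDP X A) where
  prob : List (X × A) → X → A → ℝ
  prob_nonneg : ∀ h x a, 0 ≤ prob h x a
  prob_sum : ∀ h x, ∑ a, prob h x a = 1
  prob_allowed : ∀ h x a, prob h x a ≠ 0 → D.allowed x a

/-- The expected total reward over the next `N` steps, given the history `h` and the current
state `x`. -/
def expTotal (D : MDP X A) (π : D.Policy) : ℕ → List (X × A) → X → ℝ
  | 0, _, _ => 0
  | N + 1, h, x =>
      ∑ a, π.prob h x a *
        (D.reward x a + ∑ y, D.trans x a y * expTotal D π N ((x, a) :: h) y)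

/-- The expected average reward per step over the first `N` steps, started in `x`. -/
noncomputable def finiteAverage (D : MDP X A) (π : D.Policy) (x : X) (N : ℕ) : ℝ :=
  D.expTotal π N [] x / N

/-- The time-average reward of the policy `π` started in `x` exists and equals `g`. -/
def HasAverage (D : MDP X A) (π : D.Policy) (x : X) (g : ℝ) : Prop :=
  Tendsto (D.finiteAverage π x) atTop (𝓝 g)

noncomputable def upperAverage (D : MDP X A) (π : D.Policy) (x : X) : ℝ :=
  limsup (D.finiteAverage π x) atTop

noncomputable def lowerAverage (D : MDP X A) (π : D.Policy) (x : X) : ℝ :=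
  liminf (D.finiteAverage π x) atTop

/-- The optimal time-average reward from `x`: the supremum over all policies. -/
noncomputable def optimalAverage (D : MDP X A) (x : X) : ℝ :=
  ⨆ π : D.Policy, D.upperAverage π x

/-- A policy is average optimal if, from every starting state, no policy does better. -/
def IsAverageOptimal (D : MDP X A) (σ : D.Policy) : Prop :=
  ∀ x, ∀ π : D.Policy, D.upperAverage π x ≤ D.lowerAverage σ x

/-- The stationary deterministic policy given by a decision rule. -/
def stationary [DecidableEq A] (D : MDP X A) (f : X → A) (hf : ∀ x, D.allowed x (f x)) :
    D.Policy where
  prob _ x a := if a = f x then 1 else 0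
  prob_nonneg _ _ _ := by split_ifs <;> norm_num
  prob_sum _ _ := by simp
  prob_allowed _ x a h := by
    have h1 : a = f x := by
      by_contra hne
      simp [hne] at h
    rw [h1]
    exact hf x

end MDP

/-! ### Machines -/

/-- A machine with set `S` of active states: transition probabilities `p`, rewards `r` per time
step, costs `c` for being sent to repair, success probability `s` of the geometric repair time,
and the initial active state `init`, to which the machine returns after a repair. -/
structure Machine (S : Type) [Fintype S] where
  p : S → S → ℝ
  p_nonneg : ∀ u v, 0 ≤ p u v
  p_sum : ∀ u, ∑ v, p u v = 1
  r : S → ℝ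
  r_nonneg : ∀ u, 0 ≤ r u
  c : S → ℝ
  c_nonneg : ∀ u, 0 ≤ c u
  s : ℝ
  s_pos : 0 < s
  s_le_one : s ≤ 1
  init : S

/-- The status of a machine: in an active state, in the repair queue with its repair not yet
started, or in the repair queue with its repair under way. -/
inductive Status (S : Type) where
  | active (u : S)
  | waiting
  | serving
  deriving DecidableEq, Fintype

/-- What a scheduling policy may decide for a machine at the beginning of a time slot: leave it
alone; move it to the repair queue, where it waits; or start its repair (moving it to the repair
queue first, if it is still active). -/
inductive Decision where
  | keep
  | enqueue
  | repair
  deriving DecidableEq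

instance : Fintype Decision where
  elems := {.keep, .enqueue, .repair}
  complete x := by cases x <;> simp

namespace Status

variable {S : Type}

/-- The status during the time slot, after the decision has been carried out.  A repair that is
under way goes on whatever the decision: repairs are non-preemptive. -/
def after : Status S → Decision → Status S
  | active u, .keep => active u
  | active _, .enqueue => waiting
  | active _, .repair => serving
  | waiting, .repair => serving
  | waiting, _ => waiting
  | serving, _ => serving

def isServing : Status S → Bool
  | serving => true
  | _ => false

end Status

namespace Machine

variable {S : Type} [Fintype S]

/-- The reward of a time slot minus the cost of moving the machine to the repair queue.  Only a
machine that stays active earns a reward. -/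
def slotReward (m : Machine S) : Status S → Decision → ℝ
  | .active u, .keep => m.r u
  | .active u, _ => -m.c u
  | _, _ => 0

/-- The probability that a machine with status `z` during a time slot has status `y` at the
beginning of the next one. -/
def step [DecidableEq S] (m : Machine S) : Status S → Status S → ℝ
  | .active u, .active v => m.p u v
  | .active _, _ => 0
  | .waiting, .waiting => 1
  | .waiting, _ => 0
  | .serving, .active v => if v = m.init then m.s else 0
  | .serving, .serving => 1 - m.s
  | .serving, .waiting => 0

theorem step_nonneg [DecidableEq S] (m : Machine S) (z y : Status S) : 0 ≤ m.step z y := by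
  have h1 := m.s_pos
  have h2 := m.s_le_one
  cases z <;> cases y <;> simp only [step]
  case active.active u v => exact m.p_nonneg u v
  case serving.active v => split_ifs <;> linarith
  case serving.serving => linarith
  all_goals norm_num

theorem sum_status (f : Status S → ℝ) :
    ∑ y, f y = (∑ v, f (.active v)) + f .waiting + f .serving := by
  let e : S ⊕ Bool ≃ Status S :=
    { toFun := fun y => match y with
        | .inl u => .active u
        | .inr false => .waiting
        | .inr true => .serving
      invFun := fun y => match y with
        | .active u => Sum.inl u
        | .waiting => Sum.inr false
        | .serving => Sum.inr true
      left_inv := by rintro (u | (_ | _)) <;> rfl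
      right_inv := by intro y; cases y <;> rfl }
  rw [← Equiv.sum_comp e f, Fintype.sum_sum_type, Fintype.sum_bool]
  simp only [e, Equiv.coe_fn_mk]
  ring

theorem step_sum [DecidableEq S] (m : Machine S) (z : Status S) : ∑ y, m.step z y = 1 := by
  rw [sum_status]
  cases z <;> simp [step, m.p_sum]

/-- The single-machine problem with penalty `pen` per maintenance step: the machine has the
repair facility for itself, so that its repair starts as soon as it is sent to the repair queue,
and `pen` is charged in every time slot in which it is under repair. -/
def penaltyMDP [DecidableEq S] (m : Machine S) (pen : ℝ) : MDP (Status S) Decision where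
  allowed x a := x.after a ≠ .waiting
  exists_allowed x := ⟨.repair, by cases x <;> simp [Status.after]⟩
  reward x a := m.slotReward x a - if (x.after a).isServing then pen else 0
  trans x a y := m.step (x.after a) y
  trans_nonneg x a y := m.step_nonneg _ y
  trans_sum x a := m.step_sum _

/-- The Whittle index of the active state `u`: the largest penalty per maintenance step for which
an optimal single-machine policy still sends the machine to maintenance in state `u`. -/
noncomputable def whittleIndex [DecidableEq S] (m : Machine S) (u : S) : EReal :=
  sSup ((fun pen : ℝ => (pen : EReal)) ''
    {pen : ℝ | ∃ (f : Status S → Decision) (hf : ∀ x, (m.penaltyMDP pen).allowed x (f x)),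
      (m.penaltyMDP pen).IsAverageOptimal ((m.penaltyMDP pen).stationary f hf) ∧
        f (.active u) = .repair})

end Machine

/-! ### Non-preemptive machine replenishment -/

section Replenishment

variable {ι : Type} [Fintype ι] [DecidableEq ι] {S : ι → Type} [∀ i, Fintype (S i)]
  [∀ i, DecidableEq (S i)]

/-- The number of machines under repair. -/
def numServing (z : ∀ i, Status (S i)) : ℕ :=
  (Finset.univ.filter fun i => (z i).isServing = true).card

/-- The status of all machines during the time slot, after the decisions. -/
def afterAll (x : ∀ i, Status (S i)) (a : ι → Decision) : ∀ i, Status (S i) :=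
  fun i => (x i).after (a i)

/-- Machine replenishment with independent machines `m i`, when at most `M` machines can be under
repair at any time: new repairs may be started only if at most `M` are then under way. -/
def replenishment (m : ∀ i, Machine (S i)) (M : ℕ) :
    MDP (∀ i, Status (S i)) (ι → Decision) where
  allowed x a :=
    (∃ i, (x i).isServing = false ∧ ((x i).after (a i)).isServing = true) →
      numServing (afterAll x a) ≤ M
  exists_allowed x := ⟨fun _ => .keep, by
    rintro ⟨i, h1, h2⟩
    exfalso
    revert h1 h2
    cases x i <;> simp [Status.after, Status.isServing]⟩
  reward x a := ∑ i, (m i).slotReward (x i) (a i)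
  trans x a y := ∏ i, (m i).step ((x i).after (a i)) (y i)
  trans_nonneg x a y := Finset.prod_nonneg fun i _ => (m i).step_nonneg _ _
  trans_sum x a := by
    have h := Finset.prod_univ_sum (fun i : ι => (Finset.univ : Finset (Status (S i))))
      (fun i y => (m i).step ((x i).after (a i)) y)
    rw [Fintype.piFinset_univ] at h
    rw [← h]
    exact Finset.prod_eq_one fun i _ => (m i).step_sum _

/-- All machines are in their initial active state. -/
def allInitial (m : ∀ i, Machine (S i)) : ∀ i, Status (S i) :=
  fun i => .active (m i).init

/-- The decisions `a` in the joint state `x` follow the Whittle indices: whenever the repair of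
fewer than `M` machines is under way, the free capacity is given to the active machines of
highest index among those of non-negative index (after machines already waiting in the queue, if
there are any).  Ties may be broken arbitrarily. -/
structure IsWhittleAction (m : ∀ i, Machine (S i)) (M : ℕ) (x : ∀ i, Status (S i))
    (a : ι → Decision) : Prop where
  allowed : (replenishment m M).allowed x a
  not_enqueue : ∀ i, a i ≠ .enqueue
  index_nonneg : ∀ i u, x i = .active u → a i = .repair → 0 ≤ (m i).whittleIndex u
  highest : ∀ i u j v, x i = .active u → a i = .repair → x j = .active v → a j ≠ .repair →
    (m j).whittleIndex v ≤ (m i).whittleIndex u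
  no_idling : ∀ j v, x j = .active v → 0 ≤ (m j).whittleIndex v → a j ≠ .repair →
    M ≤ numServing (afterAll x a)
  waiting_no_idling : ∀ j, x j = .waiting → a j ≠ .repair → M ≤ numServing (afterAll x a)
  waiting_first : ∀ j, x j = .waiting → a j ≠ .repair → ∀ i u, x i = .active u → a i ≠ .repair

/-- A Whittle index policy: all its choices, in every situation, follow the Whittle indices. -/
def IsWhittlePolicy (m : ∀ i, Machine (S i)) (M : ℕ) (π : (replenishment m M).Policy) : Prop :=
  ∀ h x a, π.prob h x a ≠ 0 → IsWhittleAction m M x a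

end Replenishment

/-! ### The instances -/

/-- The active states of a machine that is either good or broken. -/
inductive Cond where
  | good
  | broken
  deriving DecidableEq

instance : Fintype Cond where
  elems := {.good, .broken}
  complete x := by cases x <;> simp

/-- A machine that earns `1` per time step while good, breaks with probability `q` per step,
earns nothing once broken, stays broken until repaired, and can be sent to repair for free. -/
def twoStateMachine (q s : ℝ) (hq0 : 0 ≤ q) (hq1 : q ≤ 1) (hs0 : 0 < s) (hs1 : s ≤ 1) :
    Machine Cond where
  p u v := match u, v with
    | .good, .good => 1 - q
    | .good, .broken => q
    | .broken, .good => 0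
    | .broken, .broken => 1
  p_nonneg u v := by
    cases u <;> cases v <;> simp only <;> linarith
  p_sum u := by
    have h : (Finset.univ : Finset Cond) = {.good, .broken} := by decide
    cases u <;> simp [h]
  r u := match u with
    | .good => 1
    | .broken => 0
  r_nonneg u := by cases u <;> simp
  c _ := 0
  c_nonneg _ := le_refl _
  s := s
  s_pos := hs0
  s_le_one := hs1
  init := .good

/-- Two machines: the first breaks with probability `1 / n` per step and its repair ends with
probability `1 / n ^ 4` per step; the second always breaks after one step, and its repair always
takes one step. -/
noncomputable def gapMachines (n : ℕ) (hn : 2 ≤ n) : Fin 2 → Machine Cond :=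
  have h1 : (1 : ℝ) ≤ n := by exact_mod_cast (by omega : 1 ≤ n)
  ![twoStateMachine (1 / n) (1 / n ^ 4) (by positivity)
      (by rw [div_le_one (by linarith)]; exact h1) (by positivity)
      (by rw [div_le_one (by positivity)]; exact one_le_pow₀ h1),
    twoStateMachine 1 1 zero_le_one le_rfl zero_lt_one le_rfl]

/-!
Both bounds rest on the evaluation equation of average-reward Markov decision processes: if a
potential `v` satisfies `r + E v ≤ g + v` along every transition, the total reward over `N` slots
is at most `N g + O(1)`, and likewise for `≥` and `=`.

Leaving the first machine broken and repairing the second one every other slot earns `1 / 2` per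
slot. This is optimal, since a repair of the first machine blocks the second one for `n ^ 4` slots
on average and so costs about `n ^ 4 / 2`, while it gains only a run of `n` good slots. The Whittle
index of a broken machine is nevertheless `s / q > 0`, so an index policy starts that repair as
soon as it finds the first machine broken and the second one good. Between two such repairs the
machines earn `O(n)`, while each repair takes `n ^ 4` slots, and the average is `O(1 / n ^ 3)`.
-/

section WeightedSums

variable {ι : Type*} [Fintype ι] {w f : ι → ℝ} {c : ℝ}

theorem sum_mul_le_of_sum_eq_one (hw : ∀ i, 0 ≤ w i) (hw1 : ∑ i, w i = 1)
    (hf : ∀ i, w i ≠ 0 → f i ≤ c) : ∑ i, w i * f i ≤ c :=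
  calc ∑ i, w i * f i ≤ ∑ i, w i * c := by
        refine Finset.sum_le_sum fun i _ => ?_
        rcases eq_or_ne (w i) 0 with hi | hi
        · simp only [hi, zero_mul, le_refl]
        · exact mul_le_mul_of_nonneg_left (hf i hi) (hw i)
    _ = c := by rw [← Finset.sum_mul, hw1, one_mul]

theorem le_sum_mul_of_sum_eq_one (hw : ∀ i, 0 ≤ w i) (hw1 : ∑ i, w i = 1)
    (hf : ∀ i, w i ≠ 0 → c ≤ f i) : c ≤ ∑ i, w i * f i := by
  have h := sum_mul_le_of_sum_eq_one (f := fun i => -f i) hw hw1 fun i hi => neg_le_neg (hf i hi)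
  simpa only [mul_neg, Finset.sum_neg_distrib, neg_le_neg_iff] using h

end WeightedSums

theorem tendsto_natCast_mul_add_div_natCast (g K : ℝ) :
    Tendsto (fun N : ℕ => (N * g + K) / N) atTop (𝓝 g) := by
  have h := (tendsto_const_nhds (x := g)).add (tendsto_const_div_atTop_nhds_zero_nat K)
  rw [add_zero] at h
  refine h.congr' ?_
  filter_upwards [eventually_ne_atTop 0] with N hN
  field_simp

namespace MDP

variable {X A : Type} [Fintype X] [Fintype A] {D : MDP X A}

/-- The expected reward of taking the action `a` in the state `x` and collecting the terminal
value `v` one step later: the right-hand side of the Bellman equations. -/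
def lookahead (D : MDP X A) (v : X → ℝ) (x : X) (a : A) : ℝ :=
  D.reward x a + ∑ y, D.trans x a y * v y

theorem lookahead_add_const (v : X → ℝ) (c : ℝ) (x : X) (a : A) :
    D.lookahead (fun y => v y + c) x a = D.lookahead v x a + c := by
  simp only [lookahead, mul_add, Finset.sum_add_distrib, ← Finset.sum_mul, D.trans_sum, one_mul,
    add_assoc]

theorem lookahead_mono {v w : X → ℝ} {x : X} {a : A}
    (h : ∀ y, D.trans x a y ≠ 0 → v y ≤ w y) : D.lookahead v x a ≤ D.lookahead w x a := by
  refine add_le_add_right (Finset.sum_le_sum fun y _ => ?_) _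
  rcases eq_or_ne (D.trans x a y) 0 with hy | hy
  · simp only [hy, zero_mul, le_refl]
  · exact mul_le_mul_of_nonneg_left (h y hy) (D.trans_nonneg x a y)

/-- A set of states which the process controlled by `π` almost surely never leaves, whatever the
history. -/
def Policy.Preserves (π : D.Policy) (I : Set X) : Prop :=
  ∀ ⦃h x a y⦄, x ∈ I → π.prob h x a ≠ 0 → D.trans x a y ≠ 0 → y ∈ I

theorem Policy.preserves_univ (π : D.Policy) : π.Preserves Set.univ :=
  fun _ _ _ _ _ _ _ => Set.mem_univ _

section Potential

variable {π : D.Policy} {I : Set X} {v : X → ℝ} {g : ℝ}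

theorem expTotal_le (hI : π.Preserves I)
    (hv : ∀ h, ∀ x ∈ I, ∀ a, π.prob h x a ≠ 0 → D.lookahead v x a ≤ g + v x)
    {b : ℝ} (hb : ∀ x, b ≤ v x) (N : ℕ) :
    ∀ h, ∀ x ∈ I, D.expTotal π N h x ≤ N * g + (v x - b) := by
  induction N with
  | zero =>
    intro h x _
    simpa [expTotal] using hb x
  | succ N ih =>
    intro h x hx
    refine sum_mul_le_of_sum_eq_one (π.prob_nonneg h x) (π.prob_sum h x) fun a ha => ?_
    calc D.lookahead (D.expTotal π N ((x, a) :: h)) x a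
        ≤ D.lookahead (fun y => v y + (N * g - b)) x a :=
          lookahead_mono fun y hy => (ih _ y (hI hx ha hy)).trans_eq (by ring)
      _ = D.lookahead v x a + (N * g - b) := lookahead_add_const _ _ _ _
      _ ≤ (N + 1 : ℕ) * g + (v x - b) := by
          push_cast
          linarith [hv h x hx a ha]

theorem le_expTotal (hI : π.Preserves I)
    (hv : ∀ h, ∀ x ∈ I, ∀ a, π.prob h x a ≠ 0 → g + v x ≤ D.lookahead v x a)
    {B : ℝ} (hB : ∀ x, v x ≤ B) (N : ℕ) :
    ∀ h, ∀ x ∈ I, N * g + (v x - B) ≤ D.expTotal π N h x := by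
  induction N with
  | zero =>
    intro h x _
    simpa [expTotal] using hB x
  | succ N ih =>
    intro h x hx
    refine le_sum_mul_of_sum_eq_one (π.prob_nonneg h x) (π.prob_sum h x) fun a ha => ?_
    calc (N + 1 : ℕ) * g + (v x - B) ≤ D.lookahead v x a + (N * g - B) := by
          push_cast
          linarith [hv h x hx a ha]
      _ = D.lookahead (fun y => v y + (N * g - B)) x a := (lookahead_add_const _ _ _ _).symm
      _ ≤ D.lookahead (D.expTotal π N ((x, a) :: h)) x a :=
          lookahead_mono fun y hy => (ih _ y (hI hx ha hy)).trans_eq' (by ring)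

theorem exists_finiteAverage_le (hI : π.Preserves I)
    (hv : ∀ h, ∀ x ∈ I, ∀ a, π.prob h x a ≠ 0 → D.lookahead v x a ≤ g + v x)
    {x : X} (hx : x ∈ I) : ∃ K : ℝ, ∀ N : ℕ, D.finiteAverage π x N ≤ (N * g + K) / N := by
  obtain ⟨b, hb⟩ := (Set.finite_range v).bddBelow
  exact ⟨v x - b, fun N => div_le_div_of_nonneg_right
    (expTotal_le hI hv (fun y => hb ⟨y, rfl⟩) N [] x hx) N.cast_nonneg⟩

theorem exists_le_finiteAverage (hI : π.Preserves I)
    (hv : ∀ h, ∀ x ∈ I, ∀ a, π.prob h x a ≠ 0 → g + v x ≤ D.lookahead v x a)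
    {x : X} (hx : x ∈ I) : ∃ K : ℝ, ∀ N : ℕ, (N * g + K) / N ≤ D.finiteAverage π x N := by
  obtain ⟨B, hB⟩ := (Set.finite_range v).bddAbove
  exact ⟨v x - B, fun N => div_le_div_of_nonneg_right
    (le_expTotal hI hv (fun y => hB ⟨y, rfl⟩) N [] x hx) N.cast_nonneg⟩

theorem hasAverage_of_potential (hI : π.Preserves I)
    (hv : ∀ h, ∀ x ∈ I, ∀ a, π.prob h x a ≠ 0 → D.lookahead v x a = g + v x)
    {x : X} (hx : x ∈ I) : D.HasAverage π x g := by
  obtain ⟨K, hK⟩ := exists_finiteAverage_le hI (fun h x hx a ha => (hv h x hx a ha).le) hx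
  obtain ⟨L, hL⟩ := exists_le_finiteAverage hI (fun h x hx a ha => (hv h x hx a ha).ge) hx
  exact tendsto_of_tendsto_of_tendsto_of_le_of_le (tendsto_natCast_mul_add_div_natCast g L)
    (tendsto_natCast_mul_add_div_natCast g K) hL hK

theorem isBoundedUnder_ge_finiteAverage (π : D.Policy) (x : X) :
    IsBoundedUnder (· ≥ ·) atTop (D.finiteAverage π x) := by
  obtain ⟨R, hR⟩ := (Set.finite_range fun z : X × A => D.reward z.1 z.2).bddBelow
  obtain ⟨K, hK⟩ := exists_le_finiteAverage (v := 0) (g := R) π.preserves_univ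
    (fun _ y _ a _ => by simpa [lookahead] using hR ⟨(y, a), rfl⟩) (Set.mem_univ x)
  exact (tendsto_natCast_mul_add_div_natCast R K).isBoundedUnder_ge.mono_ge (.of_forall hK)

theorem upperAverage_le_of_potential (hI : π.Preserves I)
    (hv : ∀ h, ∀ x ∈ I, ∀ a, π.prob h x a ≠ 0 → D.lookahead v x a ≤ g + v x)
    {x : X} (hx : x ∈ I) : D.upperAverage π x ≤ g := by
  obtain ⟨K, hK⟩ := exists_finiteAverage_le hI hv hx
  have hlim := tendsto_natCast_mul_add_div_natCast g K
  rw [upperAverage, ← hlim.limsup_eq]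
  exact limsup_le_limsup (.of_forall hK)
    (isBoundedUnder_ge_finiteAverage π x).isCoboundedUnder_le hlim.isBoundedUnder_le

theorem upperAverage_le_of_forall_allowed
    (hv : ∀ x a, D.allowed x a → D.lookahead v x a ≤ g + v x) (π : D.Policy) (x : X) :
    D.upperAverage π x ≤ g :=
  upperAverage_le_of_potential π.preserves_univ
    (fun h x _ a ha => hv x a (π.prob_allowed h x a ha)) (Set.mem_univ x)

end Potential

section Optimality

variable {π σ : D.Policy} {x : X} {g g' : ℝ}

theorem HasAverage.upperAverage_eq (h : D.HasAverage π x g) : D.upperAverage π x = g :=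
  Tendsto.limsup_eq h

theorem HasAverage.lowerAverage_eq (h : D.HasAverage π x g) : D.lowerAverage π x = g :=
  Tendsto.liminf_eq h

theorem HasAverage.optimalAverage_eq (hσ : D.HasAverage σ x g)
    (hle : ∀ π : D.Policy, D.upperAverage π x ≤ g) : D.optimalAverage x = g := by
  have : Nonempty D.Policy := ⟨σ⟩
  refine le_antisymm (ciSup_le hle) ?_
  rw [← hσ.upperAverage_eq]
  exact le_ciSup ⟨g, Set.forall_mem_range.2 hle⟩ σ

theorem isAverageOptimal_of_hasAverage (hσ : ∀ x, D.HasAverage σ x g)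
    (hle : ∀ (π : D.Policy) x, D.upperAverage π x ≤ g) : D.IsAverageOptimal σ :=
  fun x π => (hle π x).trans_eq (hσ x).lowerAverage_eq.symm

theorem IsAverageOptimal.le_of_hasAverage (h : D.IsAverageOptimal σ) (hσ : D.HasAverage σ x g)
    (hπ : D.HasAverage π x g') : g' ≤ g := by
  simpa only [hπ.upperAverage_eq, hσ.lowerAverage_eq] using h x π

end Optimality

section Stationary

variable [DecidableEq A] {f : X → A} {hf : ∀ x, D.allowed x (f x)}

theorem eq_of_stationary_prob_ne_zero {h : List (X × A)} {x : X} {a : A}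
    (ha : (D.stationary f hf).prob h x a ≠ 0) : a = f x := by
  by_contra hne
  exact ha (if_neg hne)

theorem hasAverage_stationary {I : Set X} {v : X → ℝ} {g : ℝ}
    (hI : ∀ x ∈ I, ∀ y, D.trans x (f x) y ≠ 0 → y ∈ I)
    (hv : ∀ x ∈ I, D.lookahead v x (f x) = g + v x) {x : X} (hx : x ∈ I) :
    D.HasAverage (D.stationary f hf) x g := by
  refine hasAverage_of_potential (I := I) (v := v) ?_ ?_ hx
  · intro h x a y hx ha hy
    obtain rfl := eq_of_stationary_prob_ne_zero ha
    exact hI x hx y hy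
  · intro h x hx a ha
    obtain rfl := eq_of_stationary_prob_ne_zero ha
    exact hv x hx

end Stationary

end MDP

theorem Status.isServing_iff {S : Type} {z : Status S} : z.isServing = true ↔ z = .serving := by
  cases z <;> simp [isServing]

theorem Status.eq_active_of_after_eq_active {S : Type} {x : Status S} {a : Decision} {u : S}
    (h : x.after a = .active u) : x = .active u := by
  cases x <;> cases a <;> simp_all [after]

theorem Status.after_active_eq_serving_iff {S : Type} {u : S} {a : Decision} :
    (active u).after a = .serving ↔ a = .repair := by
  cases a <;> simp [after]

namespace Machine

variable {S : Type} [Fintype S] [DecidableEq S] (m : Machine S)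

/-- The expectation of `f` over the next status, when the status during the slot is `z`. -/
def expNext (z : Status S) (f : Status S → ℝ) : ℝ :=
  ∑ y, m.step z y * f y

theorem expNext_active (u : S) (f : Status S → ℝ) :
    m.expNext (.active u) f = ∑ v, m.p u v * f (.active v) := by
  simp [expNext, sum_status, step]

theorem expNext_waiting (f : Status S → ℝ) : m.expNext .waiting f = f .waiting := by
  simp [expNext, sum_status, step]

theorem expNext_serving (f : Status S → ℝ) :
    m.expNext .serving f = m.s * f (.active m.init) + (1 - m.s) * f .serving := by
  simp [expNext, sum_status, step]

variable {m} {pen : ℝ}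

theorem penaltyMDP_lookahead (v : Status S → ℝ) (x : Status S) (a : Decision) :
    (m.penaltyMDP pen).lookahead v x a =
      m.slotReward x a - (if x.after a = .serving then pen else 0) + m.expNext (x.after a) v := by
  simp only [MDP.lookahead, penaltyMDP, expNext, Status.isServing_iff]

theorem keep_or_repair_of_allowed_active {u : S} {a : Decision}
    (h : (m.penaltyMDP pen).allowed (.active u) a) : a = .keep ∨ a = .repair := by
  cases a <;> simp_all [penaltyMDP, Status.after]

theorem eq_repair_of_allowed_waiting {a : Decision} (h : (m.penaltyMDP pen).allowed .waiting a) :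
    a = .repair := by
  cases a <;> simp_all [penaltyMDP, Status.after]

section Stationary

variable {f : Status S → Decision} {hf : ∀ x, (m.penaltyMDP pen).allowed x (f x)}

/-- Such a machine is under repair in every slot, and is sent to the queue once per repair. -/
theorem hasAverage_stationary_of_repair_init (hinit : f (.active m.init) = .repair)
    {x : Status S} (hx : x.after (f x) = .serving) :
    (m.penaltyMDP pen).HasAverage ((m.penaltyMDP pen).stationary f hf) x
      (-(pen + m.s * m.c m.init)) := by
  let v : Status S → ℝ
    | .active u => -m.c u
    | _ => 0
  refine MDP.hasAverage_stationary (I := {y | y.after (f y) = .serving}) (v := v) ?_ ?_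
    (Set.mem_ofPred_eq ▸ hx)
  · intro y hy z hz
    rw [Set.mem_ofPred_eq] at hy
    simp only [penaltyMDP, hy] at hz
    rcases z with u | _ | _
    · have hu : u = m.init := by
        by_contra hne
        simp [step, hne] at hz
      simp [hu, hinit, Status.after]
    · simp [step] at hz
    · simp [Status.after]
  · intro y hy
    rw [Set.mem_ofPred_eq] at hy
    rw [penaltyMDP_lookahead, hy, if_pos rfl, expNext_serving]
    rcases y with u | _ | _
    · cases hu : f (.active u) <;> simp [hu, Status.after] at hy
      simp only [slotReward, v]
      ring
    all_goals
      simp only [slotReward, v]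
      ring

theorem hasAverage_stationary_of_keep_absorbing {u : S} (hu : ∀ v, v ≠ u → m.p u v = 0)
    (hkeep : f (.active u) = .keep) :
    (m.penaltyMDP pen).HasAverage ((m.penaltyMDP pen).stationary f hf) (.active u) (m.r u) := by
  refine MDP.hasAverage_stationary (I := {.active u}) (v := 0) ?_ ?_ rfl
  · rintro _ rfl z hz
    simp only [penaltyMDP, hkeep, Status.after] at hz
    rcases z with v | _ | _
    · by_contra hne
      exact hz (hu v fun h => hne (by rw [h, Set.mem_singleton_iff]))
    all_goals simp [step] at hz
  · rintro _ rfl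
    simp [penaltyMDP_lookahead, hkeep, Status.after, slotReward, expNext_active]

end Stationary

end Machine

theorem Cond.sum_eq (f : Cond → ℝ) : ∑ u, f u = f .good + f .broken := by
  rw [show (Finset.univ : Finset Cond) = {.good, .broken} from rfl]
  exact Finset.sum_pair (by decide)

section TwoStateMachine

variable {q s pen : ℝ} {hq0 : 0 ≤ q} {hq1 : q ≤ 1} {hs0 : 0 < s} {hs1 : s ≤ 1}

theorem twoStateMachine_slotReward (x : Status Cond) (a : Decision) :
    (twoStateMachine q s hq0 hq1 hs0 hs1).slotReward x a =
      if x.after a = .active .good then 1 else 0 := by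
  rcases x with (_ | _) | _ | _ <;> cases a <;>
    simp [Machine.slotReward, Status.after, twoStateMachine]

theorem twoStateMachine_expNext_good (f : Status Cond → ℝ) :
    (twoStateMachine q s hq0 hq1 hs0 hs1).expNext (.active .good) f =
      (1 - q) * f (.active .good) + q * f (.active .broken) := by
  rw [Machine.expNext_active, Cond.sum_eq]
  rfl

theorem twoStateMachine_expNext_broken (f : Status Cond → ℝ) :
    (twoStateMachine q s hq0 hq1 hs0 hs1).expNext (.active .broken) f = f (.active .broken) := by
  simp [Machine.expNext_active, Cond.sum_eq, twoStateMachine]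

theorem twoStateMachine_expNext_serving (f : Status Cond → ℝ) :
    (twoStateMachine q s hq0 hq1 hs0 hs1).expNext .serving f =
      s * f (.active .good) + (1 - s) * f .serving :=
  Machine.expNext_serving _ f

variable {f : Status Cond → Decision}
  {hf : ∀ x, ((twoStateMachine q s hq0 hq1 hs0 hs1).penaltyMDP pen).allowed x (f x)}

theorem hasAverage_stationary_of_repair_broken (hgood : f (.active .good) = .keep)
    (hbroken : f (.active .broken) = .repair) (x : Status Cond) :
    ((twoStateMachine q s hq0 hq1 hs0 hs1).penaltyMDP pen).HasAverage
      (((twoStateMachine q s hq0 hq1 hs0 hs1).penaltyMDP pen).stationary f hf) x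
      ((s - pen * q) / (q + s)) := by
  have hqs : q + s ≠ 0 := by positivity
  refine MDP.hasAverage_stationary (I := Set.univ)
    (v := fun y => if y = .active .good then (1 + pen) / (q + s) else 0)
    (fun _ _ _ _ => Set.mem_univ _) (fun x _ => ?_) (Set.mem_univ x)
  have hafter : x.after (f x) = if x = .active .good then x else .serving := by
    rcases x with (_ | _) | _ | _
    · simp [hgood, Status.after]
    · simp [hbroken, Status.after]
    · simp [Machine.eq_repair_of_allowed_waiting (hf .waiting), Status.after]
    · simp [Status.after]
  rw [Machine.penaltyMDP_lookahead, twoStateMachine_slotReward, hafter]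
  by_cases hx : x = .active .good
  · subst hx
    simp only [↓reduceIte, reduceCtorEq, Status.active.injEq, twoStateMachine_expNext_good]
    field_simp
    ring
  · simp only [hx, ↓reduceIte, reduceCtorEq, twoStateMachine_expNext_serving]
    field_simp
    ring

/-- Run the machine while it is good and repair it otherwise. -/
def repairBroken : Status Cond → Decision
  | .active .good => .keep
  | _ => .repair

theorem allowed_repairBroken (m : Machine Cond) (pen : ℝ) (x : Status Cond) :
    (m.penaltyMDP pen).allowed x (repairBroken x) := by
  rcases x with (_ | _) | _ | _ <;> simp [Machine.penaltyMDP, repairBroken, Status.after]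

/-- With penalty `-1` a slot under repair is worth as much as a good slot, and no slot is worth
more. -/
theorem isAverageOptimal_repair_of_penalty_neg_one
    {hf : ∀ x, ((twoStateMachine q s hq0 hq1 hs0 hs1).penaltyMDP (-1)).allowed x .repair} :
    ((twoStateMachine q s hq0 hq1 hs0 hs1).penaltyMDP (-1)).IsAverageOptimal
      (((twoStateMachine q s hq0 hq1 hs0 hs1).penaltyMDP (-1)).stationary (fun _ => .repair)
        hf) := by
  refine MDP.isAverageOptimal_of_hasAverage (g := 1) (fun x => ?_)
    (MDP.upperAverage_le_of_forall_allowed (v := 0) fun x a _ => ?_)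
  · have h := Machine.hasAverage_stationary_of_repair_init (hf := hf) rfl (x := x)
      (by cases x <;> rfl)
    simpa [twoStateMachine] using h
  · rw [Machine.penaltyMDP_lookahead, twoStateMachine_slotReward]
    rcases x.after a with (_ | _) | _ | _ <;> simp [Machine.expNext]

theorem twoStateMachine_whittleIndex_good (hq : 0 < q) :
    (twoStateMachine q s hq0 hq1 hs0 hs1).whittleIndex .good = ((-1 : ℝ) : EReal) := by
  have hrepair : ∀ x, ((twoStateMachine q s hq0 hq1 hs0 hs1).penaltyMDP (-1)).allowed x .repair :=
    fun x => by cases x <;> simp [Machine.penaltyMDP, Status.after]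
  refine le_antisymm (sSup_le ?_) (le_sSup ⟨-1, ⟨fun _ => .repair, hrepair,
    isAverageOptimal_repair_of_penalty_neg_one, rfl⟩, rfl⟩)
  rintro _ ⟨pen, ⟨f, hf, hopt, hgood⟩, rfl⟩
  have hle : (s - pen * q) / (q + s) ≤ -(pen + s * 0) := hopt.le_of_hasAverage
    (Machine.hasAverage_stationary_of_repair_init hgood (by simp [hgood, Status.after]))
    (hasAverage_stationary_of_repair_broken (hf := allowed_repairBroken _ pen) rfl rfl
      (.active .good))
  rw [div_le_iff₀ (by positivity)] at hle
  have hpen : pen ≤ -1 := le_of_mul_le_mul_right (by linarith) hs0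
  exact EReal.coe_le_coe_iff.2 hpen

/-- With penalty `s / q` a repair, which takes `1 / s` slots, costs exactly what the run of `1 / q`
good slots after it earns. -/
theorem isAverageOptimal_repairBroken_of_penalty_eq_div (hq : 0 < q) :
    ((twoStateMachine q s hq0 hq1 hs0 hs1).penaltyMDP (s / q)).IsAverageOptimal
      (((twoStateMachine q s hq0 hq1 hs0 hs1).penaltyMDP (s / q)).stationary repairBroken
        (allowed_repairBroken _ _)) := by
  refine MDP.isAverageOptimal_of_hasAverage (g := 0) (fun x => ?_)
    (MDP.upperAverage_le_of_forall_allowed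
      (v := fun y => if y = .active .good then 1 / q else 0) fun x a ha => ?_)
  · have h := hasAverage_stationary_of_repair_broken
      (hf := allowed_repairBroken (twoStateMachine q s hq0 hq1 hs0 hs1) (s / q)) rfl rfl x
    rwa [div_mul_cancel₀ _ hq.ne', sub_self, zero_div] at h
  · rw [Machine.penaltyMDP_lookahead, twoStateMachine_slotReward]
    rcases hz : x.after a with (_ | _) | _ | _
    · obtain rfl := Status.eq_active_of_after_eq_active hz
      simp only [↓reduceIte, reduceCtorEq, Status.active.injEq, twoStateMachine_expNext_good]
      field_simp
      linarith
    · obtain rfl := Status.eq_active_of_after_eq_active hz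
      simp [twoStateMachine_expNext_broken]
    · exact absurd hz ha
    · simp only [↓reduceIte, reduceCtorEq, twoStateMachine_expNext_serving]
      split_ifs
      · field_simp
        linarith
      · field_simp
        linarith

theorem twoStateMachine_whittleIndex_broken (hq : 0 < q) :
    (twoStateMachine q s hq0 hq1 hs0 hs1).whittleIndex .broken = ((s / q : ℝ) : EReal) := by
  refine le_antisymm (sSup_le ?_) (le_sSup ⟨s / q, ⟨repairBroken, allowed_repairBroken _ _,
    isAverageOptimal_repairBroken_of_penalty_eq_div hq, rfl⟩, rfl⟩)
  rintro _ ⟨pen, ⟨f, hf, hopt, hbroken⟩, rfl⟩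
  let keepBroken : Status Cond → Decision := fun x => if x = .active .broken then .keep else .repair
  have hallowed : ∀ x,
      ((twoStateMachine q s hq0 hq1 hs0 hs1).penaltyMDP pen).allowed x (keepBroken x) := by
    rintro ((_ | _) | _ | _) <;> simp [Machine.penaltyMDP, keepBroken, Status.after]
  have hzero : ((twoStateMachine q s hq0 hq1 hs0 hs1).penaltyMDP pen).HasAverage
      (MDP.stationary _ keepBroken hallowed) (.active .broken) 0 :=
    Machine.hasAverage_stationary_of_keep_absorbing
      (by rintro (_ | _) h <;> simp_all [twoStateMachine]) (by simp [keepBroken])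
  suffices hpen : pen ≤ s / q from EReal.coe_le_coe_iff.2 hpen
  rcases Machine.keep_or_repair_of_allowed_active (hf (.active .good)) with hgood | hgood
  · have hle := hopt.le_of_hasAverage
      (hasAverage_stationary_of_repair_broken hgood hbroken (.active .broken)) hzero
    rw [le_div_iff₀ (by positivity)] at hle
    rw [le_div_iff₀ hq]
    linarith
  · have hle : 0 ≤ -(pen + s * 0) := hopt.le_of_hasAverage
      (Machine.hasAverage_stationary_of_repair_init hgood (by simp [hbroken, Status.after])) hzero
    have : 0 < s / q := by positivity
    linarith

end TwoStateMachine

section IndependentMachines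

variable {ι : Type} [Fintype ι] [DecidableEq ι] {S : ι → Type} [∀ i, Fintype (S i)]
  [∀ i, DecidableEq (S i)] {m : ∀ i, Machine (S i)} {M : ℕ} {x : ∀ i, Status (S i)}
  {a : ι → Decision} {i : ι}

theorem IsWhittleAction.eq_keep_of_ne_repair (h : IsWhittleAction m M x a) (hi : a i ≠ .repair) :
    a i = .keep := by
  have henqueue := h.not_enqueue i
  cases hai : a i <;> simp_all

theorem IsWhittleAction.eq_keep_of_whittleIndex_neg (h : IsWhittleAction m M x a) {u : S i}
    (hx : x i = .active u) (hu : (m i).whittleIndex u < 0) : a i = .keep :=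
  h.eq_keep_of_ne_repair fun hi => (h.index_nonneg i u hx hi).not_gt hu

theorem step_ne_zero_of_replenishment_trans_ne_zero {y : ∀ i, Status (S i)}
    (h : (replenishment m M).trans x a y ≠ 0) (i : ι) :
    (m i).step (afterAll x a i) (y i) ≠ 0 := by
  simp only [replenishment] at h
  exact Finset.prod_ne_zero_iff.1 h i (Finset.mem_univ i)

end IndependentMachines

section TwoMachines

theorem numServing_fin_two {S : Fin 2 → Type} (z : ∀ i, Status (S i)) :
    numServing z =
      (if (z 0).isServing = true then 1 else 0) + if (z 1).isServing = true then 1 else 0 := by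
  rw [numServing, Finset.card_filter, Fin.sum_univ_two]

theorem one_le_numServing_iff {S : Fin 2 → Type} (z : ∀ i, Status (S i)) :
    1 ≤ numServing z ↔ z 0 = .serving ∨ z 1 = .serving := by
  rw [numServing_fin_two, ← Status.isServing_iff, ← Status.isServing_iff]
  split_ifs <;> simp_all

section Replenishment

variable {S : Fin 2 → Type} [∀ i, Fintype (S i)] [∀ i, DecidableEq (S i)]
  {m : ∀ i, Machine (S i)}

theorem replenishment_allowed_iff (x : ∀ i, Status (S i)) (a : Fin 2 → Decision) :
    (replenishment m 1).allowed x a ↔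
      ((x 0).after (a 0) = .serving → (x 1).after (a 1) = .serving →
        x 0 = .serving ∧ x 1 = .serving) := by
  simp only [replenishment, numServing_fin_two, afterAll, Status.isServing_iff,
    ← Bool.not_eq_true, Fin.exists_fin_two]
  by_cases h0 : (x 0).after (a 0) = .serving <;> by_cases h1 : (x 1).after (a 1) = .serving <;>
    simp [h0, h1]

theorem replenishment_lookahead {M : ℕ} (V : Status (S 0) → Status (S 1) → ℝ)
    (x : ∀ i, Status (S i)) (a : Fin 2 → Decision) :
    (replenishment m M).lookahead (fun y => V (y 0) (y 1)) x a =
      (m 0).slotReward (x 0) (a 0) + (m 1).slotReward (x 1) (a 1) +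
        (m 0).expNext (afterAll x a 0) fun y0 => (m 1).expNext (afterAll x a 1) (V y0) := by
  rw [MDP.lookahead, ← Equiv.sum_comp (piFinTwoEquiv fun i => Status (S i)).symm,
    Fintype.sum_prod_type]
  simp only [replenishment, afterAll, Machine.expNext, Finset.mul_sum, Fin.sum_univ_two,
    Fin.prod_univ_two, mul_assoc]
  rfl

end Replenishment

variable {m : Fin 2 → Machine Cond}

/-- The pattern of Whittle indices in the gap instance: a good machine is not repaired, and of two
broken machines the second one is. -/
structure PrioritizesSecond (m : Fin 2 → Machine Cond) : Prop where
  good_neg : ∀ i, (m i).whittleIndex .good < 0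
  broken_nonneg : 0 ≤ (m 0).whittleIndex .broken
  broken_lt : (m 0).whittleIndex .broken < (m 1).whittleIndex .broken

/-- Decisions of a Whittle index policy when the indices follow the pattern `PrioritizesSecond`, as
a function of the status of the two machines. -/
def whittleRule : Status Cond → Status Cond → Fin 2 → Decision
  | .serving, _ => ![.keep, .keep]
  | _, .serving => ![.keep, .keep]
  | _, .waiting => ![.keep, .repair]
  | .waiting, _ => ![.repair, .keep]
  | _, .active .broken => ![.keep, .repair]
  | .active .broken, _ => ![.repair, .keep]
  | _, _ => ![.keep, .keep]

theorem PrioritizesSecond.isWhittleAction_whittleRule (hm : PrioritizesSecond m)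
    (x : Fin 2 → Status Cond) : IsWhittleAction m 1 x (whittleRule (x 0) (x 1)) := by
  have hgood0 := hm.good_neg 0
  have hgood1 := hm.good_neg 1
  have hbroken0 := hm.broken_nonneg
  have hbroken := hm.broken_lt.le
  have hbroken1 := hbroken0.trans hbroken
  have hgood01 := (hgood0.trans_le hbroken1).le
  have hgood10 := (hgood1.trans_le hbroken0).le
  rcases hx0 : x 0 with (_ | _) | _ | _ <;> rcases hx1 : x 1 with (_ | _) | _ | _ <;>
    constructor <;>
    simp [replenishment_allowed_iff, one_le_numServing_iff, Fin.forall_fin_two, whittleRule,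
      Status.after, afterAll, *]

theorem PrioritizesSecond.exists_isWhittlePolicy (hm : PrioritizesSecond m) :
    ∃ π : (replenishment m 1).Policy, IsWhittlePolicy m 1 π := by
  refine ⟨(replenishment m 1).stationary _ fun x => (hm.isWhittleAction_whittleRule x).allowed,
    fun h x a ha => ?_⟩
  obtain rfl := MDP.eq_of_stationary_prob_ne_zero ha
  exact hm.isWhittleAction_whittleRule x

/-- The joint states that Whittle index policies visit from the initial state when repairs of the
second machine take one slot: once the first machine is under repair, the second one has broken. -/
def whittleStates : Set (Fin 2 → Status Cond) :=
  {x | (∃ u v, x 0 = .active u ∧ x 1 = .active v) ∨ x 0 = .serving ∧ x 1 = .active .broken}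

theorem mem_whittleStates {x : Fin 2 → Status Cond} : x ∈ whittleStates ↔
    (∃ u v, x 0 = .active u ∧ x 1 = .active v) ∨ x 0 = .serving ∧ x 1 = .active .broken := by
  rw [whittleStates, Set.mem_ofPred_eq]

theorem PrioritizesSecond.eq_repair_of_broken_good (hm : PrioritizesSecond m)
    {x : Fin 2 → Status Cond} {a : Fin 2 → Decision} (h : IsWhittleAction m 1 x a)
    (hx0 : x 0 = .active .broken) (hx1 : x 1 = .active .good) : a 0 = .repair := by
  by_contra ha0
  have ha1 := h.eq_keep_of_whittleIndex_neg hx1 (hm.good_neg 1)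
  have hserving := (one_le_numServing_iff _).1 (h.no_idling 0 _ hx0 hm.broken_nonneg ha0)
  simp [afterAll, hx0, hx1, Status.after_active_eq_serving_iff, ha0, ha1] at hserving

theorem PrioritizesSecond.eq_repair_of_active_broken (hm : PrioritizesSecond m)
    {x : Fin 2 → Status Cond} {a : Fin 2 → Decision} (h : IsWhittleAction m 1 x a) {u : Cond}
    (hx0 : x 0 = .active u) (hx1 : x 1 = .active .broken) : a 1 = .repair := by
  by_contra ha1
  have hserving := (one_le_numServing_iff _).1
    (h.no_idling 1 _ hx1 (hm.broken_nonneg.trans hm.broken_lt.le) ha1)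
  have ha0 : a 0 = .repair := by
    simpa [afterAll, hx0, hx1, Status.after_active_eq_serving_iff, ha1] using hserving
  have hu : (m 0).whittleIndex u ≤ (m 0).whittleIndex .broken := by
    cases u
    · exact ((hm.good_neg 0).trans_le hm.broken_nonneg).le
    · exact le_rfl
  exact ((h.highest 0 u 1 _ hx0 ha0 hx1 ha1).trans hu).not_gt hm.broken_lt

theorem PrioritizesSecond.afterAll_eq (hm : PrioritizesSecond m) {x : Fin 2 → Status Cond}
    {a : Fin 2 → Decision} (h : IsWhittleAction m 1 x a) (hx : x ∈ whittleStates) :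
    afterAll x a = afterAll x (whittleRule (x 0) (x 1)) := by
  have hallowed := (replenishment_allowed_iff x a).1 h.allowed
  obtain ⟨u, v, hx0, hx1⟩ | ⟨hx0, hx1⟩ := mem_whittleStates.1 hx
  · cases v with
    | broken =>
      have ha1 := hm.eq_repair_of_active_broken h hx0 hx1
      have ha0 : a 0 = .keep := h.eq_keep_of_ne_repair fun ha0 => by
        simp [hx0, hx1, ha0, ha1, Status.after] at hallowed
      ext i
      fin_cases i <;> cases u <;> simp [afterAll, hx0, hx1, ha0, ha1, whittleRule]
    | good =>
      have ha1 := h.eq_keep_of_whittleIndex_neg hx1 (hm.good_neg 1)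
      cases u with
      | good =>
        have ha0 := h.eq_keep_of_whittleIndex_neg hx0 (hm.good_neg 0)
        ext i
        fin_cases i <;> simp [afterAll, hx0, hx1, ha0, ha1, whittleRule]
      | broken =>
        have ha0 := hm.eq_repair_of_broken_good h hx0 hx1
        ext i
        fin_cases i <;> simp [afterAll, hx0, hx1, ha0, ha1, whittleRule]
  · have ha1 : a 1 = .keep := h.eq_keep_of_ne_repair fun ha1 => by
      simp [hx0, hx1, ha1, Status.after] at hallowed
    ext i
    fin_cases i <;> simp [afterAll, hx0, hx1, ha1, whittleRule, Status.after]

end TwoMachines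

section GapPair

/-- The gap instance with the breaking probability `p` and the repair probability `s` of the first
machine as parameters; `gapMachines n` is the case `p = 1 / n`, `s = 1 / n ^ 4`. -/
def gapPair (p s : ℝ) (hp0 : 0 ≤ p) (hp1 : p ≤ 1) (hs0 : 0 < s) (hs1 : s ≤ 1) :
    Fin 2 → Machine Cond :=
  ![twoStateMachine p s hp0 hp1 hs0 hs1, twoStateMachine 1 1 zero_le_one le_rfl zero_lt_one le_rfl]

variable {p s : ℝ} {hp0 : 0 ≤ p} {hp1 : p ≤ 1} {hs0 : 0 < s} {hs1 : s ≤ 1}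

theorem gapPair_lookahead (V : Status Cond → Status Cond → ℝ) (x : Fin 2 → Status Cond)
    (a : Fin 2 → Decision) :
    (replenishment (gapPair p s hp0 hp1 hs0 hs1) 1).lookahead (fun y => V (y 0) (y 1)) x a =
      (if afterAll x a 0 = .active .good then 1 else 0) +
        (if afterAll x a 1 = .active .good then 1 else 0) +
        (twoStateMachine p s hp0 hp1 hs0 hs1).expNext (afterAll x a 0) fun y0 =>
          (twoStateMachine 1 1 zero_le_one le_rfl zero_lt_one le_rfl).expNext (afterAll x a 1)
            (V y0) := by
  rw [replenishment_lookahead]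
  simp only [gapPair, Matrix.cons_val_zero, Matrix.cons_val_one, twoStateMachine_slotReward,
    afterAll]
  rfl

theorem second_status_of_gapPair_trans_ne_zero {x y : Fin 2 → Status Cond}
    {a : Fin 2 → Decision} (h : (replenishment (gapPair p s hp0 hp1 hs0 hs1) 1).trans x a y ≠ 0) :
    y 1 = match afterAll x a 1 with
      | .active _ => .active .broken
      | .waiting => .waiting
      | .serving => .active .good := by
  have hstep := step_ne_zero_of_replenishment_trans_ne_zero h 1
  simp only [gapPair, Matrix.cons_val_one] at hstep
  generalize afterAll x a 1 = z at hstep ⊢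
  generalize y 1 = y1 at hstep ⊢
  rcases z with (_ | _) | _ | _ <;> rcases y1 with (_ | _) | _ | _ <;>
    simp [Machine.step, twoStateMachine] at hstep ⊢

theorem first_status_of_gapPair_trans_ne_zero {x y : Fin 2 → Status Cond} {a : Fin 2 → Decision}
    (h : (replenishment (gapPair p s hp0 hp1 hs0 hs1) 1).trans x a y ≠ 0)
    (hx : afterAll x a 0 ≠ .waiting) :
    (∃ u, y 0 = .active u) ∨ afterAll x a 0 = .serving ∧ y 0 = .serving := by
  have hstep := step_ne_zero_of_replenishment_trans_ne_zero h 0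
  generalize afterAll x a 0 = z at hstep hx ⊢
  generalize y 0 = y0 at hstep ⊢
  rcases z with _ | _ | _ <;> rcases y0 with _ | _ | _ <;> simp_all [Machine.step]

/-- A supersolution of the optimality equation with average reward `1 / 2`. The good first machine
is worth the `1 / p` slots it still runs, the good second machine the half slot by which it is
ahead. A repair of the first machine takes `1 / s` slots, in each of which the idle second machine
forgoes `1 / 2`; only then is the gain `1 / p` realized. -/
noncomputable def gapPotential (p s : ℝ) : Status Cond → Status Cond → ℝ
  | .active .good, .active .good => p⁻¹ + 1 / 2
  | .active .good, _ => p⁻¹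
  | .serving, .active .good => p⁻¹ - s⁻¹ / 2 + 1
  | .serving, .serving => p⁻¹ - s⁻¹ / 2 + 1
  | .serving, _ => p⁻¹ - s⁻¹ / 2
  | _, .active .good => 1 / 2
  | _, _ => 0

theorem gapPotential_optimality (hp : 0 < p) (hp1 : p ≤ 1) (hps : p⁻¹ + 1 / 2 ≤ s⁻¹ / 2)
    {x0 x1 : Status Cond} {a0 a1 : Decision}
    (ha : x0.after a0 = .serving → x1.after a1 = .serving → x0 = .serving ∧ x1 = .serving) :
    (if x0.after a0 = .active .good then 1 else 0) +
        (if x1.after a1 = .active .good then 1 else 0) +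
        ((twoStateMachine p s hp0 hp1 hs0 hs1).expNext (x0.after a0) fun y0 =>
          (twoStateMachine 1 1 zero_le_one le_rfl zero_lt_one le_rfl).expNext (x1.after a1)
            (gapPotential p s y0)) ≤
      1 / 2 + gapPotential p s x0 x1 := by
  have hpp : p * p⁻¹ = 1 := mul_inv_cancel₀ hp.ne'
  have hss : s * s⁻¹ = 1 := mul_inv_cancel₀ hs0.ne'
  have hpp1 : 1 ≤ p⁻¹ := (one_le_inv₀ hp).2 hp1
  rcases x0 with (_ | _) | _ | _ <;> rcases x1 with (_ | _) | _ | _ <;>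
    cases a0 <;> cases a1 <;>
    first
    | exact absurd (ha rfl rfl) (by decide)
    | simp only [Status.after, twoStateMachine_expNext_good, twoStateMachine_expNext_broken,
        twoStateMachine_expNext_serving, Machine.expNext_waiting, gapPotential, ↓reduceIte,
        reduceCtorEq, Status.active.injEq]
      linarith

theorem gapPair_upperAverage_le (hp : 0 < p) (hps : p⁻¹ + 1 / 2 ≤ s⁻¹ / 2)
    (π : (replenishment (gapPair p s hp0 hp1 hs0 hs1) 1).Policy) (x : Fin 2 → Status Cond) :
    (replenishment (gapPair p s hp0 hp1 hs0 hs1) 1).upperAverage π x ≤ 1 / 2 := by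
  refine MDP.upperAverage_le_of_forall_allowed (v := fun y => gapPotential p s (y 0) (y 1))
    (fun x a ha => ?_) π x
  rw [gapPair_lookahead]
  exact gapPotential_optimality hp hp1 hps ((replenishment_allowed_iff x a).1 ha)

/-- Never start a repair of the first machine, and unless one is under way, repair the second
machine whenever it is not good. -/
def repairSecond (x : Fin 2 → Status Cond) : Fin 2 → Decision :=
  ![.keep, if x 0 = .serving ∨ x 1 = .active .good then .keep else .repair]

theorem allowed_repairSecond (m : Fin 2 → Machine Cond) (x : Fin 2 → Status Cond) :
    (replenishment m 1).allowed x (repairSecond x) := by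
  rw [replenishment_allowed_iff]
  simp only [repairSecond, Matrix.cons_val_zero, Matrix.cons_val_one]
  generalize x 0 = x0
  generalize x 1 = x1
  rcases x0 with _ | _ | _ <;> rcases x1 with _ | _ | _ <;> simp [Status.after]

theorem afterAll_repairSecond {x : Fin 2 → Status Cond} {u v : Cond} (hu : x 0 = .active u)
    (hv : x 1 = .active v) :
    afterAll x (repairSecond x) 0 = .active u ∧
      afterAll x (repairSecond x) 1 = if v = .good then .active .good else .serving := by
  cases v <;> simp [afterAll, repairSecond, hu, hv, Status.after]

theorem gapPair_hasAverage_repairSecond (hp : 0 < p) :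
    (replenishment (gapPair p s hp0 hp1 hs0 hs1) 1).HasAverage
      ((replenishment (gapPair p s hp0 hp1 hs0 hs1) 1).stationary repairSecond
        (allowed_repairSecond _))
      (allInitial (gapPair p s hp0 hp1 hs0 hs1)) (1 / 2) := by
  let I : Set (Fin 2 → Status Cond) := {x | ∃ u v, x 0 = .active u ∧ x 1 = .active v}
  have mem_I {x} : x ∈ I ↔ ∃ u v, x 0 = .active u ∧ x 1 = .active v := by
    rw [Set.mem_ofPred_eq]
  refine MDP.hasAverage_stationary (I := I) (v := fun y => gapPotential p s (y 0) (y 1))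
    (fun x hx y hy => ?_) (fun x hx => ?_) (mem_I.2 ⟨_, _, rfl, rfl⟩)
  · obtain ⟨u, v, hu, hv⟩ := mem_I.1 hx
    obtain ⟨hafter0, hafter1⟩ := afterAll_repairSecond hu hv
    have h0 := first_status_of_gapPair_trans_ne_zero hy (by simp [hafter0])
    have h1 := second_status_of_gapPair_trans_ne_zero hy
    obtain ⟨u', hu'⟩ : ∃ u', y 0 = .active u' := by simpa [hafter0] using h0
    obtain ⟨v', hv'⟩ : ∃ v', y 1 = .active v' := by cases v <;> simp [h1, hafter1]
    exact mem_I.2 ⟨u', v', hu', hv'⟩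
  · obtain ⟨u, v, hu, hv⟩ := mem_I.1 hx
    obtain ⟨hafter0, hafter1⟩ := afterAll_repairSecond hu hv
    have hpp : p * p⁻¹ = 1 := mul_inv_cancel₀ hp.ne'
    rw [gapPair_lookahead, hafter0, hafter1, hu, hv]
    cases u <;> cases v <;>
      simp only [twoStateMachine_expNext_good, twoStateMachine_expNext_broken,
        twoStateMachine_expNext_serving, gapPotential, ↓reduceIte, reduceCtorEq,
        Status.active.injEq] <;>
      linarith

theorem gapPair_optimalAverage (hp : 0 < p) (hps : p⁻¹ + 1 / 2 ≤ s⁻¹ / 2) :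
    (replenishment (gapPair p s hp0 hp1 hs0 hs1) 1).optimalAverage
      (allInitial (gapPair p s hp0 hp1 hs0 hs1)) = 1 / 2 :=
  (gapPair_hasAverage_repairSecond hp).optimalAverage_eq
    fun π => gapPair_upperAverage_le hp hps π _

theorem gapPair_prioritizesSecond (hsp : s < p) :
    PrioritizesSecond (gapPair p s hp0 hp1 hs0 hs1) := by
  have hp : 0 < p := hs0.trans hsp
  have hgood0 := twoStateMachine_whittleIndex_good (hq0 := hp0) (hq1 := hp1) (hs0 := hs0)
    (hs1 := hs1) hp
  have hgood1 := twoStateMachine_whittleIndex_good (hq0 := zero_le_one) (hq1 := le_rfl)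
    (hs0 := zero_lt_one) (hs1 := le_rfl) one_pos
  have hbroken0 := twoStateMachine_whittleIndex_broken (hq0 := hp0) (hq1 := hp1) (hs0 := hs0)
    (hs1 := hs1) hp
  have hbroken1 := twoStateMachine_whittleIndex_broken (hq0 := zero_le_one) (hq1 := le_rfl)
    (hs0 := zero_lt_one) (hs1 := le_rfl) one_pos
  have hneg : ((-1 : ℝ) : EReal) < 0 := EReal.coe_neg'.2 neg_one_lt_zero
  refine ⟨Fin.forall_fin_two.2 ⟨hgood0.trans_lt hneg, hgood1.trans_lt hneg⟩,
    (EReal.coe_nonneg.2 (by positivity)).trans_eq hbroken0.symm, hbroken0.trans_lt ?_⟩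
  refine lt_of_lt_of_eq (EReal.coe_lt_coe_iff.2 ?_) hbroken1.symm
  rwa [div_one, div_lt_one hp]

/-- The time-average reward of the Whittle index policies on `gapPair p s`. A cycle between two
completed repairs of the first machine has expected reward `(3 - p ^ 2) / (p * (2 - p))` and
expected length `(2 - p ^ 2) / (p * (2 - p)) + 1 / s`. -/
noncomputable def whittleAverage (p s : ℝ) : ℝ :=
  (3 - p ^ 2) / (2 - p ^ 2 + p * (2 - p) / s)

theorem whittleAverage_denominator_pos (hp0 : 0 ≤ p) (hp1 : p ≤ 1) (hs : 0 < s) :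
    0 < 2 - p ^ 2 + p * (2 - p) / s := by
  have hp2 : p ^ 2 ≤ 1 := pow_le_one₀ hp0 hp1
  have hrepair : 0 ≤ p * (2 - p) / s := div_nonneg (mul_nonneg hp0 (by linarith)) hs.le
  linarith

theorem whittleAverage_pos (hp0 : 0 ≤ p) (hp1 : p ≤ 1) (hs : 0 < s) : 0 < whittleAverage p s :=
  div_pos (by linarith [pow_le_one₀ hp0 hp1 (n := 2)]) (whittleAverage_denominator_pos hp0 hp1 hs)

theorem whittleAverage_le (hp : 0 < p) (hp1 : p ≤ 1) (hs : 0 < s) :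
    whittleAverage p s ≤ 3 * s / p := by
  have hp2 : p ^ 2 ≤ 1 := pow_le_one₀ hp.le hp1
  have hrepair : p / s ≤ p * (2 - p) / s := by
    gcongr
    nlinarith
  calc whittleAverage p s ≤ 3 / (p / s) :=
        div_le_div₀ (by norm_num) (by linarith [sq_nonneg p]) (by positivity) (by linarith)
    _ = 3 * s / p := by field_simp

/-- The relative values of the joint states under the Whittle index policies, normalized to be `0`
just after a repair of the first machine and outside `whittleStates`. -/
noncomputable def whittlePotential (p s : ℝ) : Status Cond → Status Cond → ℝ
  | .active .good, .active .good =>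
      2 - whittleAverage p s + p * (1 - whittleAverage p s / s - whittleAverage p s)
  | .active .broken, .active .good => 1 - whittleAverage p s / s
  | .active .broken, .active .broken => 1 - whittleAverage p s / s - whittleAverage p s
  | .serving, .active .broken => -(whittleAverage p s / s)
  | _, _ => 0

theorem whittleAverage_eq_one_add_whittlePotential (hp0 : 0 ≤ p) (hp1 : p ≤ 1) (hs : 0 < s) :
    whittleAverage p s = 1 + (1 - p) * whittlePotential p s (.active .good) (.active .good) +
      p * whittlePotential p s (.active .broken) (.active .good) := by
  have hmul : whittleAverage p s * (2 - p ^ 2 + p * (2 - p) / s) = 3 - p ^ 2 :=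
    div_mul_cancel₀ _ (whittleAverage_denominator_pos hp0 hp1 hs).ne'
  simp only [whittlePotential]
  linear_combination hmul

theorem IsWhittlePolicy.preserves_whittleStates
    {π : (replenishment (gapPair p s hp0 hp1 hs0 hs1) 1).Policy} (hsp : s < p)
    (hπ : IsWhittlePolicy (gapPair p s hp0 hp1 hs0 hs1) 1 π) : π.Preserves whittleStates := by
  intro h x a y hx ha hy
  have hafter := (gapPair_prioritizesSecond hsp).afterAll_eq (hπ h x a ha) hx
  have h1 := second_status_of_gapPair_trans_ne_zero hy
  have h0 := first_status_of_gapPair_trans_ne_zero hy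
  rw [hafter] at h0 h1
  rw [mem_whittleStates]
  obtain ⟨u, v, hu, hv⟩ | ⟨hu, hv⟩ := mem_whittleStates.1 hx
  · cases u <;> cases v <;> simp_all [afterAll, whittleRule, Status.after]
  · simp_all [afterAll, whittleRule, Status.after]

theorem IsWhittlePolicy.hasAverage_gapPair
    {π : (replenishment (gapPair p s hp0 hp1 hs0 hs1) 1).Policy} (hsp : s < p)
    (hπ : IsWhittlePolicy (gapPair p s hp0 hp1 hs0 hs1) 1 π) :
    (replenishment (gapPair p s hp0 hp1 hs0 hs1) 1).HasAverage π
      (allInitial (gapPair p s hp0 hp1 hs0 hs1)) (whittleAverage p s) := by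
  refine MDP.hasAverage_of_potential (v := fun y => whittlePotential p s (y 0) (y 1))
    (hπ.preserves_whittleStates hsp) (fun h x hx a ha => ?_)
    (mem_whittleStates.2 (.inl ⟨_, _, rfl, rfl⟩))
  rw [gapPair_lookahead, (gapPair_prioritizesSecond hsp).afterAll_eq (hπ h x a ha) hx]
  have hcycle := whittleAverage_eq_one_add_whittlePotential hp0 hp1 hs0
  have hrepair : s * (whittleAverage p s / s) = whittleAverage p s := mul_div_cancel₀ _ hs0.ne'
  simp only [whittlePotential] at hcycle
  obtain ⟨u, v, hu, hv⟩ | ⟨hu, hv⟩ := mem_whittleStates.1 hx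
  · cases u <;> cases v <;>
      simp only [afterAll, hu, hv, whittleRule, Matrix.cons_val_zero, Matrix.cons_val_one,
        Status.after, twoStateMachine_expNext_good, twoStateMachine_expNext_broken,
        twoStateMachine_expNext_serving, whittlePotential, ↓reduceIte, reduceCtorEq,
        Status.active.injEq] <;>
      linarith
  · simp only [afterAll, hu, hv, whittleRule, Matrix.cons_val_zero, Matrix.cons_val_one,
      Status.after, twoStateMachine_expNext_broken, twoStateMachine_expNext_serving,
      whittlePotential, ↓reduceIte, reduceCtorEq, Status.active.injEq]
    linarith

end GapPair

theorem one_div_pow_four_lt_one_div {r : ℝ} (hr : 1 < r) : 1 / r ^ 4 < 1 / r :=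
  one_div_lt_one_div_of_lt (zero_lt_one.trans hr) (lt_self_pow₀ hr (by norm_num))

theorem add_half_le_half_pow_four {r : ℝ} (hr : 2 ≤ r) : r + 1 / 2 ≤ r ^ 4 / 2 := by
  have hcube : 2 ^ 3 ≤ r ^ 3 := pow_le_pow_left₀ zero_le_two hr 3
  calc r + 1 / 2 ≤ 2 ^ 3 * r / 2 := by linarith
    _ ≤ r ^ 3 * r / 2 := by gcongr
    _ = r ^ 4 / 2 := by ring

theorem whittleAverage_one_div_le {r : ℝ} (hr : 1 ≤ r) :
    whittleAverage (1 / r) (1 / r ^ 4) ≤ 3 / r ^ 3 :=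
  calc whittleAverage (1 / r) (1 / r ^ 4) ≤ 3 * (1 / r ^ 4) / (1 / r) :=
        whittleAverage_le (by positivity) ((div_le_one (by positivity)).2 hr) (by positivity)
    _ = 3 / r ^ 3 := by field_simp

section GapMachines

variable {n : ℕ} (hn : 2 ≤ n)

theorem exists_gapMachines_eq_gapPair : ∃ hp0 hp1 hs0 hs1,
    gapMachines n hn = gapPair (1 / n) (1 / n ^ 4) hp0 hp1 hs0 hs1 := by
  have hn1 : (1 : ℝ) ≤ n := Nat.one_le_cast.2 (one_le_two.trans hn)
  exact ⟨by positivity, (div_le_one (by positivity)).2 hn1, by positivity,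
    (div_le_one (by positivity)).2 (one_le_pow₀ hn1), rfl⟩

theorem gapMachines_optimalAverage :
    (replenishment (gapMachines n hn) 1).optimalAverage (allInitial (gapMachines n hn)) =
      1 / 2 := by
  obtain ⟨_, _, _, _, h⟩ := exists_gapMachines_eq_gapPair hn
  rw [h]
  refine gapPair_optimalAverage (by positivity) ?_
  simpa only [one_div, inv_inv] using add_half_le_half_pow_four (Nat.ofNat_le_cast.2 hn)

theorem exists_hasAverage_half_gapMachines : ∃ π : (replenishment (gapMachines n hn) 1).Policy,
    (replenishment (gapMachines n hn) 1).HasAverage π (allInitial (gapMachines n hn)) (1 / 2) := by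
  obtain ⟨_, _, _, _, h⟩ := exists_gapMachines_eq_gapPair hn
  rw [h]
  exact ⟨_, gapPair_hasAverage_repairSecond (by positivity)⟩

theorem exists_isWhittlePolicy_gapMachines :
    ∃ π : (replenishment (gapMachines n hn) 1).Policy, IsWhittlePolicy (gapMachines n hn) 1 π := by
  obtain ⟨_, _, _, _, h⟩ := exists_gapMachines_eq_gapPair hn
  rw [h]
  exact (gapPair_prioritizesSecond
    (one_div_pow_four_lt_one_div (Nat.one_lt_cast.2 hn))).exists_isWhittlePolicy

theorem exists_hasAverage_le_of_isWhittlePolicy_gapMachines :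
    ∀ π : (replenishment (gapMachines n hn) 1).Policy, IsWhittlePolicy (gapMachines n hn) 1 π →
      ∃ w : ℝ, (replenishment (gapMachines n hn) 1).HasAverage π (allInitial (gapMachines n hn)) w ∧
        0 < w ∧ w ≤ 3 / (n : ℝ) ^ 3 := by
  obtain ⟨hp0, hp1, hs0, _, h⟩ := exists_gapMachines_eq_gapPair hn
  rw [h]
  exact fun π hπ =>
    ⟨whittleAverage (1 / n) (1 / n ^ 4),
      hπ.hasAverage_gapPair (one_div_pow_four_lt_one_div (Nat.one_lt_cast.2 hn)),
      whittleAverage_pos hp0 hp1 hs0,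
      whittleAverage_one_div_le (Nat.one_le_cast.2 (one_le_two.trans hn))⟩

end GapMachines

theorem mainTheorem5 :
    (∃ C : ℝ, 0 < C ∧ ∀ (n : ℕ) (hn : 2 ≤ n),
      (replenishment (gapMachines n hn) 1).optimalAverage (allInitial (gapMachines n hn)) = 1 / 2 ∧
      (∃ π : (replenishment (gapMachines n hn) 1).Policy,
        (replenishment (gapMachines n hn) 1).HasAverage π (allInitial (gapMachines n hn)) (1 / 2)) ∧
      (∃ π : (replenishment (gapMachines n hn) 1).Policy,
        IsWhittlePolicy (gapMachines n hn) 1 π) ∧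
      ∀ π : (replenishment (gapMachines n hn) 1).Policy, IsWhittlePolicy (gapMachines n hn) 1 π →
        ∃ w : ℝ, (replenishment (gapMachines n hn) 1).HasAverage π
            (allInitial (gapMachines n hn)) w ∧
          0 < w ∧ w ≤ C / (n : ℝ) ^ 3) ∧
    (∀ α : ℝ, ∃ (n : ℕ) (hn : 2 ≤ n), ∀ π : (replenishment (gapMachines n hn) 1).Policy,
      IsWhittlePolicy (gapMachines n hn) 1 π →
        α * (replenishment (gapMachines n hn) 1).upperAverage π (allInitial (gapMachines n hn)) <
          (replenishment (gapMachines n hn) 1).optimalAverage (allInitial (gapMachines n hn))) := by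
  refine ⟨⟨3, three_pos, fun n hn => ⟨gapMachines_optimalAverage hn,
    exists_hasAverage_half_gapMachines hn, exists_isWhittlePolicy_gapMachines hn,
    exists_hasAverage_le_of_isWhittlePolicy_gapMachines hn⟩⟩, fun α => ?_⟩
  have hlim : Tendsto (fun n : ℕ => |α| * 3 / (n : ℝ) ^ 3) atTop (𝓝 0) :=
    (tendsto_const_div_pow _ 3 three_ne_zero).comp tendsto_natCast_atTop_atTop
  obtain ⟨n, hn, hlt⟩ :=
    ((eventually_ge_atTop 2).and (hlim.eventually_lt_const one_half_pos)).exists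
  refine ⟨n, hn, fun π hπ => ?_⟩
  obtain ⟨w, hw, hw0, hwn⟩ := exists_hasAverage_le_of_isWhittlePolicy_gapMachines hn π hπ
  rw [hw.upperAverage_eq, gapMachines_optimalAverage]
  calc α * w ≤ |α| * w := mul_le_mul_of_nonneg_right (le_abs_self α) hw0.le
    _ ≤ |α| * (3 / (n : ℝ) ^ 3) := mul_le_mul_of_nonneg_left hwn (abs_nonneg α)
    _ = |α| * 3 / (n : ℝ) ^ 3 := (mul_div_assoc _ _ _).symm
    _ < 1 / 2 := hlt
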